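/- For $n\ge 1$ let $B_n^+$ be the monoid of positive $n$-strand braids, generated by $\sigma_1,\dots,\sigma_{n-1}$ with the relations $\sigma_i\sigma_j=\sigma_j\sigma_i$ for $|i-j|\ge 2$ and $\sigma_i\sigma_j\sigma_i=\sigma_j\sigma_i\sigma_j$ for $|i-j|=1$. For $n\ge 2$ regard $B_{n-1}^+$ as the submonoid of $B_n^+$ generated by $\sigma_1,\dots,\sigma_{n-2}$, via the natural embedding. Let $\Phi_n$ be the automorphism of $B_n^+$ that maps $\sigma_i$ to $\sigma_{n-i}$ for each $i$. For $n\ge 3$, the $n$-splitting of $x\in B_n^+$ is the unique sequence $(x_p,\dots,x_1)$ of elements of $B_{n-1}^+$, with $p\ge 1$, such that $$x=\Phi_n^{p-1}(x_p)\cdots\Phi_n(x_2)\,x_1$$ and, for each $r$ with $2\le r\le p$, the only generator $\sigma_i$ that is a right divisor of $\Phi_n^{p-r}(x_p)\cdots\Phi_n(x_{r+1})\,x_r$ is $\sigma_1$ (where $y$ is a right divisor of $x$ if $x=zy$ for some $z$). Define relations $<_n^+$ on $B_n^+$, $n\ge 2$, recursively as follows. For $n=2$, $x<_2^+y$ holds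 if $x=\sigma_1^p$ and $y=\sigma_1^q$ with $p<q$. For $n\ge 3$, if $(x_p,\dots,x_1)$ and $(y_q,\dots,y_1)$ are the $n$-splittings of $x$ and $y$, then $x<_n^+y$ holds if either $p<q$, or $p=q$ and there is $r\le p$ such that $x_{r'}=y_{r'}$ for $p\ge r'>r$ and $x_r<_{n-1}^+y_r$. (i) For $n\ge 2$, the relation $<_n^+$ is a (strict) linear ordering of $B_n^+$, which is a well-ordering. For each $x\in B_n^+$, the immediate $<_n^+$-successor of $x$ is $x\sigma_1$. (ii) For $n\ge 3$, the order $<_n^+$ extends the order $<_{n-1}^+$, and $B_{n-1}^+$ is the initial segment of $B_n^+$ determined by $\sigma_{n-1}$, i.e., $B_{n-1}^+=\{x\in B_n^+\mid x<_n^+\sigma_{n-1}\}$. -/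

import Mathlib

/-- Index set `{1, …, n - 1}` of the standard generators of the `n`-strand braid monoid. -/
abbrev BraidIndex (n : ℕ) : Type := {i : ℕ // 1 ≤ i ∧ i < n}

/-- The braid relations on words in `σ_1, …, σ_{n-1}`. -/
inductive BraidRel (n : ℕ) : FreeMonoid (BraidIndex n) → FreeMonoid (BraidIndex n) → Prop
  | comm (i j : BraidIndex n) (h : i.1 + 2 ≤ j.1 ∨ j.1 + 2 ≤ i.1) :
      BraidRel n (FreeMonoid.of i * FreeMonoid.of j) (FreeMonoid.of j * FreeMonoid.of i)
  | braid (i j : BraidIndex n) (h : i.1 + 1 = j.1 ∨ j.1 + 1 = i.1) :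
      BraidRel n (FreeMonoid.of i * FreeMonoid.of j * FreeMonoid.of i)
        (FreeMonoid.of j * FreeMonoid.of i * FreeMonoid.of j)

/-- The monoid `B_n^+` of positive `n`-strand braids. -/
abbrev BraidMonoid (n : ℕ) : Type := PresentedMonoid (BraidRel n)

namespace BraidMonoid

/-- The generator `σ_i` of `B_n^+`, for `1 ≤ i ≤ n - 1`. -/
def σ {n : ℕ} (i : BraidIndex n) : BraidMonoid n := PresentedMonoid.of (BraidRel n) i

/-- The generator `σ_1` of `B_n^+`, for `n ≥ 2`. -/
def σFirst (n : ℕ) (hn : 2 ≤ n) : BraidMonoid n := σ ⟨1, le_refl 1, hn⟩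

/-- The generator `σ_{n-1}` of `B_n^+`, for `n ≥ 2`. -/
def σLast (n : ℕ) (hn : 2 ≤ n) : BraidMonoid n := σ ⟨n - 1, by omega, by omega⟩

theorem σ_comm {n : ℕ} (i j : BraidIndex n) (h : i.1 + 2 ≤ j.1 ∨ j.1 + 2 ≤ i.1) :
    σ i * σ j = σ j * σ i :=
  PresentedMonoid.mk_eq_mk_of_rel (BraidRel.comm i j h)

theorem σ_braid {n : ℕ} (i j : BraidIndex n) (h : i.1 + 1 = j.1 ∨ j.1 + 1 = i.1) :
    σ i * σ j * σ i = σ j * σ i * σ j :=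
  PresentedMonoid.mk_eq_mk_of_rel (BraidRel.braid i j h)

/-- The flip of indices `i ↦ n - i`. -/
def flipIndex {n : ℕ} (i : BraidIndex n) : BraidIndex n :=
  ⟨n - i.1, by have := i.2; omega, by have := i.2; omega⟩

/-- The flip automorphism `Φ_n` of `B_n^+`, which maps `σ_i` to `σ_{n-i}`. -/
def flip (n : ℕ) : BraidMonoid n →* BraidMonoid n :=
  PresentedMonoid.lift (fun i => σ (flipIndex i)) (by
    rintro _ _ (⟨i, j, h⟩ | ⟨i, j, h⟩)
    · have hi := i.2
      have hj := j.2
      simpa using σ_comm (flipIndex i) (flipIndex j) (by simp only [flipIndex]; omega)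
    · have hi := i.2
      have hj := j.2
      simpa using σ_braid (flipIndex i) (flipIndex j) (by simp only [flipIndex]; omega))

/-- An index of an `n`-strand generator, seen as an index of an `(n+1)`-strand generator. -/
def castIndex {n : ℕ} (i : BraidIndex n) : BraidIndex (n + 1) :=
  ⟨i.1, i.2.1, Nat.lt_succ_of_lt i.2.2⟩

/-- The inclusion of `B_n^+` into `B_{n+1}^+`, which maps `σ_i` to `σ_i`. -/
def incl (n : ℕ) : BraidMonoid n →* BraidMonoid (n + 1) :=
  PresentedMonoid.lift (fun i => σ (castIndex i)) (by
    rintro _ _ (⟨i, j, h⟩ | ⟨i, j, h⟩)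
    · simpa using σ_comm (castIndex i) (castIndex j) h
    · simpa using σ_braid (castIndex i) (castIndex j) h)

/-- `y` is a right divisor of `x`. -/
def IsRightDivisor {n : ℕ} (y x : BraidMonoid n) : Prop := ∃ z, x = z * y

/-- The `(n+1)`-strand braid `Φ^{p-1}(x_p) ⋯ Φ(x_2) x_1` attached to a list `[x_p, …, x_1]` of
`n`-strand braids, where `Φ = Φ_{n+1}`. -/
def altProd {n : ℕ} (l : List (BraidMonoid n)) : BraidMonoid (n + 1) :=
  l.foldl (fun a x => flip (n + 1) a * incl n x) 1

/-- The nonempty list `l = [x_p, …, x_1]` of `n`-strand braids is the `(n+1)`-splitting of `x`: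
`x = Φ^{p-1}(x_p) ⋯ Φ(x_2) x_1`, and, for `2 ≤ r ≤ p`, the only generator `σ_i` that is a right
divisor of `Φ^{p-r}(x_p) ⋯ Φ(x_{r+1}) x_r` is `σ_1`. Here `[x_p, …, x_r]` is `l.take k` with
`k = p - r + 1`, so that `1 ≤ k < p`. -/
def IsSplitting {n : ℕ} (x : BraidMonoid (n + 1)) (l : List (BraidMonoid n)) : Prop :=
  l ≠ [] ∧ altProd l = x ∧
    ∀ k, 1 ≤ k → k < l.length →
      ∀ i : BraidIndex (n + 1), IsRightDivisor (σ i) (altProd (l.take k)) ↔ i.1 = 1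

/-- The relation `<_n^+` on `B_n^+`, which is meant for `n ≥ 2` (it is empty for `n ≤ 1`):
the order of exponents for `n = 2`, and the `ShortLex`-extension (first compare the lengths, then
compare lexicographically from the left) of `<_{n-1}^+` through `n`-splittings for `n ≥ 3`. -/
def lt : (n : ℕ) → BraidMonoid n → BraidMonoid n → Prop
  | 0, _, _ => False
  | 1, _, _ => False
  | 2, x, y => ∃ p q : ℕ, p < q ∧ x = σFirst 2 le_rfl ^ p ∧ y = σFirst 2 le_rfl ^ q
  | n + 3, x, y => ∃ l m : List (BraidMonoid (n + 2)),
      IsSplitting x l ∧ IsSplitting y m ∧ List.Shortlex (lt (n + 2)) l m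

end BraidMonoid

namespace BraidMonoid

variable {n : ℕ}

/-! ### Induction principles, length and reversal -/

/-! By definition `lt` is the pull-back of a ShortLex order along the map sending a braid to its
splitting, so the first task is to show that splittings exist and are unique (`exists_isSplitting`,
`IsSplitting.unique`). Every `x` in `B_{n+1}^+` factors uniquely as `y * incl n b` with `y` right
divisible by none of `σ_1, …, σ_{n-1}`; the entry `b` is split off, `y` is flipped, and the process
repeats. Uniqueness of this factorization rests on Garside's theory: right cancellation and the lcm
of two generators, both consequences of `cofactors_of_σ_mul_eq`.

Given splittings, the order is handled by induction from `B_2^+`, which is `ℕ` by length. The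
ShortLex extension of a well-order is a well-order (`isWellOrder_lt`). Right multiplication by `σ_1`
only multiplies the last entry by `σ_1`, which gives successors (`lt_mul_σFirst_and_not_between`).
The splitting of `σ_n` in `B_{n+1}^+` is `(σ_1, 1)`, and below it only the one-entry splittings
remain, that is, `B_n^+` (`range_incl_eq`). -/

@[elab_as_elim]
theorem induction_left {P : BraidMonoid n → Prop} (x : BraidMonoid n) (one : P 1)
    (mul : ∀ i x, P x → P (σ i * x)) : P x := by
  obtain ⟨w, rfl⟩ := PresentedMonoid.surjective_mk x
  induction w using FreeMonoid.inductionOn' with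
  | one => exact one
  | of_mul i w ih => exact mul i _ ih

/-- The homomorphism that maps every generator to `1`. -/
def lengthHom (n : ℕ) : BraidMonoid n →* Multiplicative ℕ :=
  PresentedMonoid.lift (fun _ => Multiplicative.ofAdd 1) (by
    rintro _ _ (⟨i, j, h⟩ | ⟨i, j, h⟩) <;> simp)

/-- The length of a positive braid. -/
def length (x : BraidMonoid n) : ℕ := (lengthHom n x).toAdd

@[simp] theorem length_one : length (1 : BraidMonoid n) = 0 := by simp [length]

@[simp] theorem length_mul (x y : BraidMonoid n) : length (x * y) = length x + length y := by
  simp [length]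

@[simp] theorem length_σ (i : BraidIndex n) : length (σ i) = 1 := rfl

theorem length_mk (w : FreeMonoid (BraidIndex n)) :
    length (PresentedMonoid.mk (BraidRel n) w) = w.length := by
  induction w using FreeMonoid.inductionOn' with
  | one => simp
  | of_mul i w ih => rw [map_mul, length_mul, ih, FreeMonoid.length_mul]; rfl

/-- The anti-automorphism that fixes every generator. -/
def revHom (n : ℕ) : BraidMonoid n →* (BraidMonoid n)ᵐᵒᵖ :=
  PresentedMonoid.lift (fun i => MulOpposite.op (σ i)) (by
    rintro _ _ (⟨i, j, h⟩ | ⟨i, j, h⟩)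
    · simpa [← MulOpposite.op_mul] using (σ_comm i j h).symm
    · simpa [← MulOpposite.op_mul, ← mul_assoc] using σ_braid i j h)

/-- The reversal of a positive braid. -/
def rev (x : BraidMonoid n) : BraidMonoid n := (revHom n x).unop

@[simp] theorem rev_one : rev (1 : BraidMonoid n) = 1 := by simp [rev]

@[simp] theorem rev_mul (x y : BraidMonoid n) : rev (x * y) = rev y * rev x := by simp [rev]

@[simp] theorem rev_σ (i : BraidIndex n) : rev (σ i) = σ i := rfl

@[simp] theorem rev_rev (x : BraidMonoid n) : rev (rev x) = x := by
  induction x using induction_left with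
  | one => simp
  | mul i x ih => simp [ih]

@[elab_as_elim]
theorem induction_right {P : BraidMonoid n → Prop} (x : BraidMonoid n) (one : P 1)
    (mul : ∀ x i, P x → P (x * σ i)) : P x := by
  have : ∀ y : BraidMonoid n, P (rev y) := fun y => by
    induction y using induction_left with
    | one => simpa using one
    | mul i y ih => simpa using mul _ i ih
  simpa using this (rev x)

/-! ### Cancellation and common multiples of generators -/

/-- The indices of two generators that commute. -/
def Far (i j : BraidIndex n) : Prop := i.1 + 2 ≤ j.1 ∨ j.1 + 2 ≤ i.1

/-- The indices of two generators that satisfy the relation of length three. -/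
def Near (i j : BraidIndex n) : Prop := i.1 + 1 = j.1 ∨ j.1 + 1 = i.1

theorem Far.symm {i j : BraidIndex n} (h : Far i j) : Far j i := Or.symm h

theorem Near.symm {i j : BraidIndex n} (h : Near i j) : Near j i := Or.symm h

theorem eq_or_far_or_near (i j : BraidIndex n) : i = j ∨ Far i j ∨ Near i j := by
  rw [Subtype.ext_iff, Far, Near]; omega

theorem Far.comm {i j : BraidIndex n} (h : Far i j) (x : BraidMonoid n) :
    σ i * (σ j * x) = σ j * (σ i * x) := by
  rw [← mul_assoc, σ_comm i j h, mul_assoc]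

theorem Near.braid {i j : BraidIndex n} (h : Near i j) (x : BraidMonoid n) :
    σ i * (σ j * (σ i * x)) = σ j * (σ i * (σ j * x)) := by
  have := congrArg (· * x) (σ_braid i j h)
  simpa only [mul_assoc] using this

/-- `σ_i x = σ_j y` is a right multiple of the right lcm of `σ_i` and `σ_j`, expressed by its two
cofactors `x` and `y`. -/
def Cofactors (i j : BraidIndex n) (x y : BraidMonoid n) : Prop :=
  (i = j ∧ x = y) ∨ (Far i j ∧ ∃ w, x = σ j * w ∧ y = σ i * w) ∨
    (Near i j ∧ ∃ w, x = σ j * (σ i * w) ∧ y = σ i * (σ j * w))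

namespace Cofactors

variable {i j k : BraidIndex n} {x y z : BraidMonoid n}

theorem refl (i : BraidIndex n) (x : BraidMonoid n) : Cofactors i i x x := .inl ⟨rfl, rfl⟩

theorem symm (h : Cofactors i j x y) : Cofactors j i y x := by
  rcases h with ⟨rfl, rfl⟩ | ⟨h, w, rfl, rfl⟩ | ⟨h, w, rfl, rfl⟩
  · exact refl _ _
  · exact .inr (.inl ⟨h.symm, w, rfl, rfl⟩)
  · exact .inr (.inr ⟨h.symm, w, rfl, rfl⟩)

theorem mul_right (h : Cofactors i j x y) (t : BraidMonoid n) : Cofactors i j (x * t) (y * t) := by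
  rcases h with ⟨rfl, rfl⟩ | ⟨h, w, rfl, rfl⟩ | ⟨h, w, rfl, rfl⟩
  · exact refl _ _
  · exact .inr (.inl ⟨h, w * t, by simp only [mul_assoc], by simp only [mul_assoc]⟩)
  · exact .inr (.inr ⟨h, w * t, by simp only [mul_assoc], by simp only [mul_assoc]⟩)

theorem eq_of_self (h : Cofactors i i x y) : x = y := by
  rcases h with ⟨-, h⟩ | ⟨h, -⟩ | ⟨h, -⟩
  · exact h
  · rcases h with h | h <;> omega
  · rcases h with h | h <;> omega

theorem of_far (h : Cofactors i j x y) (hij : Far i j) : ∃ w, x = σ j * w ∧ y = σ i * w := by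
  rcases h with ⟨rfl, h⟩ | ⟨-, h⟩ | ⟨h, -⟩
  · rcases hij with h | h <;> omega
  · exact h
  · rw [Far] at hij; rcases h with h | h <;> omega

theorem of_near (h : Cofactors i j x y) (hij : Near i j) :
    ∃ w, x = σ j * (σ i * w) ∧ y = σ i * (σ j * w) := by
  rcases h with ⟨rfl, h⟩ | ⟨h, -⟩ | ⟨-, h⟩
  · rcases hij with h | h <;> omega
  · rw [Far] at h; rcases hij with h | h <;> omega
  · exact h

/-- Transitivity of the cofactor relation in length `N`, when the lcm property holds in smaller
lengths, `σ_i` and `σ_j` do not commute, and `σ_j` and `σ_k` commute. -/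
theorem trans_near_far {N : ℕ}
    (H : ∀ (i j : BraidIndex n) (x y : BraidMonoid n), length x < N → σ i * x = σ j * y →
      Cofactors i j x y)
    (hx : length x ≤ N) (hij : Near i j) (hjk : Far j k)
    (h₁ : Cofactors i j x y) (h₂ : Cofactors j k y z) : Cofactors i k x z := by
  obtain ⟨s, rfl, rfl⟩ := h₁.of_near hij
  obtain ⟨t, hs, rfl⟩ := h₂.of_far hjk
  simp only [length_mul, length_σ] at hx
  have h := H i k _ _ (by simp; omega) hs
  have hik : i ≠ k := by
    rintro rfl; rw [Far] at hjk; rcases hij with h | h <;> omega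
  rcases eq_or_far_or_near i k with he | hf | hn
  · exact absurd he hik
  · obtain ⟨r, hr, rfl⟩ := h.of_far hf
    obtain ⟨q, rfl, rfl⟩ := (H j k s r (by omega) hr).of_far hjk
    refine .inr (.inl ⟨hf, σ j * (σ i * q), ?_, ?_⟩)
    · rw [hf.comm, hjk.comm]
    · rw [hij.braid]
  · obtain ⟨r, hr, rfl⟩ := h.of_near hn
    obtain ⟨q, rfl, hq⟩ := (H j k s _ (by omega) hr).of_far hjk
    have hlen := congrArg length hr
    simp only [length_mul, length_σ] at hlen hx
    obtain ⟨p, rfl, rfl⟩ := (H i j r q (by omega) hq).of_near hij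
    refine .inr (.inr ⟨hn, σ j * (σ i * (σ k * p)), ?_, ?_⟩)
    · rw [hn.braid, hjk.comm, hjk.symm.comm p, hij.symm.braid]
    · rw [hjk.symm.comm, hij.symm.braid, hn.braid, hjk.comm]

/-- Garside's cube condition, checked for each configuration of three generators. Stripping the
known letters leaves equalities between shorter braids, to which `H` applies; the letters so exposed
assemble into the lcm of `σ_i` and `σ_k`. -/
theorem trans {N : ℕ}
    (H : ∀ (i j : BraidIndex n) (x y : BraidMonoid n), length x < N → σ i * x = σ j * y →
      Cofactors i j x y)
    (hx : length x ≤ N) (hz : length z ≤ N)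
    (h₁ : Cofactors i j x y) (h₂ : Cofactors j k y z) : Cofactors i k x z := by
  rcases eq_or_far_or_near i j with rfl | hij | hij
  · rwa [h₁.eq_of_self]
  · rcases eq_or_far_or_near j k with rfl | hjk | hjk
    · rwa [← h₂.eq_of_self]
    · obtain ⟨s, rfl, rfl⟩ := h₁.of_far hij
      obtain ⟨t, hs, rfl⟩ := h₂.of_far hjk
      simp only [length_mul, length_σ] at hx
      have h := H i k _ _ (by omega) hs
      rcases eq_or_far_or_near i k with rfl | hf | hn
      · rw [h.eq_of_self]; exact refl _ _
      · obtain ⟨r, rfl, rfl⟩ := h.of_far hf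
        exact .inr (.inl ⟨hf, σ j * r, hjk.comm _, hij.symm.comm _⟩)
      · obtain ⟨r, rfl, rfl⟩ := h.of_near hn
        refine .inr (.inr ⟨hn, σ j * r, ?_, ?_⟩)
        · rw [hjk.comm, hij.symm.comm]
        · rw [hij.symm.comm, hjk.comm]
    · exact (trans_near_far H hz hjk.symm hij.symm h₂.symm h₁.symm).symm
  · rcases eq_or_far_or_near j k with rfl | hjk | hjk
    · rwa [← h₂.eq_of_self]
    · exact trans_near_far H hx hij hjk h₁ h₂
    · obtain ⟨s, rfl, rfl⟩ := h₁.of_near hij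
      obtain ⟨t, hs, rfl⟩ := h₂.of_near hjk
      simp only [length_mul, length_σ] at hx hz
      have h := H i k _ _ (by simp; omega) hs
      rcases eq_or_far_or_near i k with rfl | hf | hn
      · rw [(H j j s t (by omega) h.eq_of_self).eq_of_self]; exact refl _ _
      · obtain ⟨r, hr, hr'⟩ := h.of_far hf
        obtain ⟨p, rfl, rfl⟩ := (H j k s r (by omega) hr).of_near hjk
        obtain ⟨q, rfl, hq⟩ := (H j i t _ (by omega) hr').of_near hij.symm
        have hpq := (H j j _ _ (by simp at hx ⊢; omega) hq).eq_of_self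
        obtain ⟨w, rfl, rfl⟩ := (H k i p q (by simp at hx ⊢; omega) hpq).of_far hf.symm
        refine .inr (.inl ⟨hf, σ j * (σ k * (σ i * (σ j * w))), ?_, ?_⟩)
        · rw [hf.comm, hij.braid, hjk.braid]
        · rw [hf.symm.comm, hjk.symm.braid, hij.symm.braid, hf.comm]
      -- Three indices cannot be pairwise adjacent.
      · rw [Near] at hij hjk hn; omega

end Cofactors

theorem of_mul_inj {α : Type*} {a b : α} {u v : FreeMonoid α}
    (h : FreeMonoid.of a * u = FreeMonoid.of b * v) : a = b ∧ u = v :=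
  List.cons.inj h

theorem eq_one_or_eq_of_mul {α : Type*} (u : FreeMonoid α) :
    u = 1 ∨ ∃ a v, u = FreeMonoid.of a * v := by
  induction u using FreeMonoid.inductionOn' with
  | one => exact .inl rfl
  | of_mul a v _ => exact .inr ⟨a, v, rfl⟩

theorem length_eq_of_rel {u v : FreeMonoid (BraidIndex n)} (h : ConGen.Rel (BraidRel n) u v) :
    u.length = v.length := by
  rw [← length_mk, ← length_mk, PresentedMonoid.mk_eq_mk_iff.2 h]

/-- Two generators whose right multiples agree have a right lcm, which divides the common
multiple. -/
theorem cofactors_of_σ_mul_eq {i j : BraidIndex n} {x y : BraidMonoid n}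
    (h : σ i * x = σ j * y) : Cofactors i j x y := by
  induction hN : length x using Nat.strong_induction_on generalizing i j x y with | _ N ih
  have H : ∀ (i j : BraidIndex n) (x y : BraidMonoid n), length x < N → σ i * x = σ j * y →
      Cofactors i j x y := fun i j x y hx h => ih _ hx h rfl
  -- Induction on the derivation of `u ~ v`, following first letters. The bound is `N + 1` because
  -- the first letter is not counted in `N`.
  have key : ∀ u v : FreeMonoid (BraidIndex n), ConGen.Rel (BraidRel n) u v →
      u.length ≤ N + 1 → ∀ i j u' v', u = FreeMonoid.of i * u' → v = FreeMonoid.of j * v' →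
        Cofactors i j (PresentedMonoid.mk (BraidRel n) u')
          (PresentedMonoid.mk (BraidRel n) v') := by
    intro u v huv
    induction huv with
    | of x y hxy =>
      rintro - i j u' v' hu hv
      cases hxy with
      | comm a b hab =>
        obtain ⟨rfl, rfl⟩ := of_mul_inj hu
        obtain ⟨rfl, rfl⟩ := of_mul_inj hv
        exact .inr (.inl ⟨hab, 1, (mul_one _).symm, (mul_one _).symm⟩)
      | braid a b hab =>
        rw [mul_assoc] at hu hv
        obtain ⟨rfl, rfl⟩ := of_mul_inj hu
        obtain ⟨rfl, rfl⟩ := of_mul_inj hv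
        exact .inr (.inr ⟨hab, 1, by rw [mul_one]; rfl, by rw [mul_one]; rfl⟩)
    | refl x =>
      rintro - i j u' v' rfl hv
      obtain ⟨rfl, rfl⟩ := of_mul_inj hv
      exact Cofactors.refl _ _
    | symm hr ih =>
      intro hl i j u' v' hu hv
      exact (ih ((length_eq_of_rel hr).trans_le hl) j i v' u' hv hu).symm
    | @trans x y z h₁ h₂ ih₁ ih₂ =>
      intro hl i j u' v' hu hv
      have hxy := length_eq_of_rel h₁
      have hyz := length_eq_of_rel h₂
      have hx' : x.length = 1 + u'.length := by rw [hu, FreeMonoid.length_mul]; rfl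
      have hz' : z.length = 1 + v'.length := by rw [hv, FreeMonoid.length_mul]; rfl
      -- The middle word is as long as the outer ones, so it has a first letter `k`, through which
      -- the cube condition composes the two halves.
      obtain rfl | ⟨k, w, rfl⟩ := eq_one_or_eq_of_mul y
      · rw [FreeMonoid.length_one] at hxy; omega
      · exact Cofactors.trans H (by rw [length_mk]; omega) (by rw [length_mk]; omega)
          (ih₁ hl i k u' w hu rfl) (ih₂ (by omega) k j w v' rfl hv)
    | @mul w x y z h₁ h₂ ih₁ ih₂ =>
      intro hl i j u' v' hu hv
      rw [FreeMonoid.length_mul] at hl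
      have hwx := length_eq_of_rel h₁
      obtain rfl | ⟨a, w', rfl⟩ := eq_one_or_eq_of_mul w
      · obtain rfl := FreeMonoid.length_eq_zero.1 (hwx.symm.trans FreeMonoid.length_one)
        rw [one_mul] at hu hv
        exact ih₂ (by omega) i j u' v' hu hv
      · obtain rfl | ⟨b, x', rfl⟩ := eq_one_or_eq_of_mul x
        · rw [FreeMonoid.length_one, FreeMonoid.length_mul, FreeMonoid.length_of] at hwx; omega
        · rw [mul_assoc] at hu hv
          obtain ⟨rfl, rfl⟩ := of_mul_inj hu
          obtain ⟨rfl, rfl⟩ := of_mul_inj hv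
          have hyz : PresentedMonoid.mk (BraidRel n) y = PresentedMonoid.mk (BraidRel n) z :=
            PresentedMonoid.mk_eq_mk_iff.2 h₂
          rw [map_mul, map_mul, hyz]
          exact (ih₁ (by omega) _ _ w' x' rfl rfl).mul_right _
  obtain ⟨u, rfl⟩ := PresentedMonoid.surjective_mk x
  obtain ⟨v, rfl⟩ := PresentedMonoid.surjective_mk y
  rw [length_mk] at hN
  refine key (FreeMonoid.of i * u) (FreeMonoid.of j * v) ?_ ?_ i j u v rfl rfl
  · exact PresentedMonoid.mk_eq_mk_iff.1 h
  · rw [FreeMonoid.length_mul, FreeMonoid.length_of]; omega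

theorem cofactors_rev_of_mul_σ_eq {i j : BraidIndex n} {x y : BraidMonoid n}
    (h : x * σ i = y * σ j) : Cofactors i j (rev x) (rev y) :=
  cofactors_of_σ_mul_eq (by simpa using congrArg rev h)

theorem mul_σ_right_cancel {i : BraidIndex n} {x y : BraidMonoid n} (h : x * σ i = y * σ i) :
    x = y := by
  simpa using congrArg rev (cofactors_rev_of_mul_σ_eq h).eq_of_self

/-- If `σ_i` and `σ_j` commute and both right divide `x σ_i`, then `σ_j` right divides `x`. -/
theorem eq_mul_σ_of_far {i j : BraidIndex n} (hij : Far i j) {x y : BraidMonoid n}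
    (h : x * σ i = y * σ j) : ∃ w, x = w * σ j := by
  obtain ⟨w, hw, -⟩ := (cofactors_rev_of_mul_σ_eq h).of_far hij
  exact ⟨rev w, by simpa using congrArg rev hw⟩

/-- If `σ_i` and `σ_j` do not commute and both right divide `x σ_i`, then `σ_i σ_j` right divides
`x`. -/
theorem eq_mul_σ_of_near {i j : BraidIndex n} (hij : Near i j) {x y : BraidMonoid n}
    (h : x * σ i = y * σ j) : ∃ w, x = w * σ i * σ j := by
  obtain ⟨w, hw, -⟩ := (cofactors_rev_of_mul_σ_eq h).of_near hij
  exact ⟨rev w, by simpa using congrArg rev hw⟩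

/-! ### Right divisors, the flip and the inclusion -/

theorem eq_one_or_eq_mul_σ (x : BraidMonoid n) : x = 1 ∨ ∃ y i, x = y * σ i := by
  induction x using induction_right with
  | one => exact .inl rfl
  | mul x i _ => exact .inr ⟨x, i, rfl⟩

theorem not_isRightDivisor_σ_one (i : BraidIndex n) : ¬ IsRightDivisor (σ i) 1 := by
  rintro ⟨z, hz⟩
  have := congrArg length hz
  simp at this

theorem isRightDivisor_σ_σ_iff {i j : BraidIndex n} : IsRightDivisor (σ i) (σ j) ↔ i = j := by
  constructor
  · rintro ⟨z, hz⟩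
    rw [← one_mul (σ j)] at hz
    rcases eq_or_far_or_near j i with h | h | h
    · exact h.symm
    · obtain ⟨w, hw⟩ := eq_mul_σ_of_far h hz
      exact absurd ⟨w, hw⟩ (not_isRightDivisor_σ_one i)
    · obtain ⟨w, hw⟩ := eq_mul_σ_of_near h hz
      exact absurd ⟨_, hw⟩ (not_isRightDivisor_σ_one i)
  · rintro rfl
    exact ⟨1, (one_mul _).symm⟩

@[simp] theorem flip_σ (i : BraidIndex n) : flip n (σ i) = σ (flipIndex i) := rfl

@[simp] theorem flipIndex_flipIndex (i : BraidIndex n) : flipIndex (flipIndex i) = i := by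
  have := i.2
  apply Subtype.ext
  simp only [flipIndex]
  omega

@[simp] theorem flip_flip (x : BraidMonoid n) : flip n (flip n x) = x := by
  induction x using induction_left with
  | one => simp
  | mul i x ih => simp [ih]

@[simp] theorem length_flip (x : BraidMonoid n) : length (flip n x) = length x := by
  induction x using induction_left with
  | one => simp
  | mul i x ih => simp [ih]

theorem isRightDivisor_σ_flip_iff {i : BraidIndex n} {x : BraidMonoid n} :
    IsRightDivisor (σ i) (flip n x) ↔ IsRightDivisor (σ (flipIndex i)) x := by
  constructor
  · rintro ⟨z, hz⟩
    exact ⟨flip n z, by simpa using congrArg (flip n) hz⟩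
  · rintro ⟨z, rfl⟩
    exact ⟨flip n z, by simp⟩

@[simp] theorem incl_σ (i : BraidIndex n) : incl n (σ i) = σ (castIndex i) := rfl

/-- The partial retraction of `B_{n+1}^+` onto `B_n^+` that is undefined, with value `0`, at the
braids in which `σ_n` occurs. -/
def retract (n : ℕ) : BraidMonoid (n + 1) →* WithZero (BraidMonoid n) :=
  PresentedMonoid.lift (fun i => if h : i.1 < n then ((σ ⟨i.1, i.2.1, h⟩ : BraidMonoid n) :
      WithZero (BraidMonoid n)) else 0) (by
    -- Both sides of a relation involve the same generators, so if one side vanishes, so does the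
    -- other.
    rintro _ _ (⟨i, j, h⟩ | ⟨i, j, h⟩)
    · by_cases hi : i.1 < n <;> by_cases hj : j.1 < n <;>
        simp only [map_mul, FreeMonoid.lift_eval_of, hi, hj, dite_true, dite_false, mul_zero,
          zero_mul]
      exact congrArg _ (σ_comm (n := n) ⟨i.1, i.2.1, hi⟩ ⟨j.1, j.2.1, hj⟩ h)
    · by_cases hi : i.1 < n <;> by_cases hj : j.1 < n <;>
        simp only [map_mul, FreeMonoid.lift_eval_of, hi, hj, dite_true, dite_false, mul_zero,
          zero_mul]
      exact congrArg _ (σ_braid (n := n) ⟨i.1, i.2.1, hi⟩ ⟨j.1, j.2.1, hj⟩ h))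

theorem retract_incl (x : BraidMonoid n) : retract n (incl n x) = x := by
  induction x using induction_left with
  | one => simp
  | mul i x ih =>
    rw [map_mul, map_mul, ih, WithZero.coe_mul]
    congr 1
    exact dif_pos i.2.2

theorem incl_injective (n : ℕ) : Function.Injective (incl n) := fun x y h =>
  WithZero.coe_injective (by rw [← retract_incl x, ← retract_incl y, h])

/-! ### The maximal right divisor in the smaller braid monoid -/

/-- No generator `σ_i` with `i < n` is a right divisor of `x`. -/
def TailFree (x : BraidMonoid (n + 1)) : Prop :=
  ∀ i : BraidIndex n, ¬ IsRightDivisor (σ (castIndex i)) x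

theorem tailFree_one : TailFree (1 : BraidMonoid (n + 1)) :=
  fun _ => not_isRightDivisor_σ_one _

/-- If `y` has no right divisor among `σ_1, …, σ_{n-1}`, then those that right divide `y b`, with
`b ∈ B_n^+`, right divide `b`. -/
theorem TailFree.isRightDivisor_of_mul_incl {y : BraidMonoid (n + 1)} (hy : TailFree y)
    {b : BraidMonoid n} {i : BraidIndex n}
    (h : IsRightDivisor (σ (castIndex i)) (y * incl n b)) : IsRightDivisor (σ i) b := by
  induction hN : length b using Nat.strong_induction_on generalizing b i with | _ N ih
  subst hN
  obtain rfl | ⟨b, j, rfl⟩ := eq_one_or_eq_mul_σ b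
  · rw [map_one, mul_one] at h
    exact absurd h (hy i)
  obtain ⟨z, hz⟩ := h
  rw [map_mul, incl_σ, ← mul_assoc] at hz
  simp only [length_mul, length_σ] at ih
  rcases eq_or_far_or_near j i with rfl | hf | hn
  · exact ⟨b, rfl⟩
  · obtain ⟨b, rfl⟩ := ih _ (by omega)
      (eq_mul_σ_of_far (i := castIndex j) (j := castIndex i) hf hz) rfl
    exact ⟨b * σ j, by rw [mul_assoc, mul_assoc, σ_comm _ _ hf]⟩
  -- Here `y b = w σ_j σ_i`. Two uses of the induction hypothesis extract `σ_i`, then `σ_j`, from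
  -- `b`, and the braid relation rewrites `σ_j σ_i σ_j` so that it ends in `σ_i`.
  · obtain ⟨w, hw⟩ := eq_mul_σ_of_near (i := castIndex j) (j := castIndex i) hn hz
    obtain ⟨b, rfl⟩ := ih _ (by omega) ⟨_, hw⟩ rfl
    rw [map_mul, incl_σ, ← mul_assoc] at hw
    obtain ⟨b, rfl⟩ := ih _ (by simp) ⟨_, mul_σ_right_cancel hw⟩ rfl
    exact ⟨b * σ i * σ j, by simpa only [mul_assoc] using congrArg (b * ·) (σ_braid _ _ hn)⟩

/-- The last letter of `a` right divides `b` by the previous lemma, so it can be cancelled on both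
sides until `a` is exhausted; a letter left in `b` would then contradict `hx`. -/
theorem TailFree.mul_incl_inj {x y : BraidMonoid (n + 1)} (hx : TailFree x) (hy : TailFree y)
    {a b : BraidMonoid n} (h : x * incl n a = y * incl n b) : x = y ∧ a = b := by
  induction a using induction_right generalizing b with
  | one =>
    obtain rfl | ⟨b, i, rfl⟩ := eq_one_or_eq_mul_σ b
    · simpa using h
    · rw [map_one, mul_one, map_mul, ← mul_assoc] at h
      exact absurd ⟨_, h⟩ (hx i)
  | mul a i ih =>
    rw [map_mul, incl_σ, ← mul_assoc] at h
    obtain ⟨b, rfl⟩ := hy.isRightDivisor_of_mul_incl ⟨_, h.symm⟩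
    rw [map_mul, incl_σ, ← mul_assoc] at h
    obtain ⟨rfl, rfl⟩ := ih (mul_σ_right_cancel h)
    exact ⟨rfl, rfl⟩

theorem exists_tailFree_mul_incl (x : BraidMonoid (n + 1)) :
    ∃ y b, TailFree y ∧ x = y * incl n b := by
  induction hN : length x using Nat.strong_induction_on generalizing x with | _ N ih
  subst hN
  by_cases h : TailFree x
  · exact ⟨x, 1, h, by simp⟩
  · simp only [TailFree, not_forall, not_not] at h
    obtain ⟨i, z, rfl⟩ := h
    obtain ⟨y, b, hy, rfl⟩ := ih _ (by simp) z rfl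
    exact ⟨y, b * σ i, hy, by rw [map_mul, incl_σ, mul_assoc]⟩

/-! ### Existence and uniqueness of splittings -/

@[simp] theorem altProd_append_singleton (l : List (BraidMonoid n)) (b : BraidMonoid n) :
    altProd (l ++ [b]) = flip (n + 1) (altProd l) * incl n b := by
  simp [altProd]

@[simp] theorem altProd_singleton (b : BraidMonoid n) : altProd [b] = incl n b := by
  simp [altProd]

/-- The generator `σ_1` is the only one that right divides `x`. -/
def OnlyFirst (x : BraidMonoid (n + 1)) : Prop :=
  ∀ i : BraidIndex (n + 1), IsRightDivisor (σ i) x ↔ i.1 = 1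

theorem isSplitting_singleton (b : BraidMonoid n) : IsSplitting (incl n b) [b] :=
  ⟨by simp, by simp, fun k h₁ h₂ => by simp at h₂; omega⟩

theorem isSplitting_append_singleton_iff {x : BraidMonoid (n + 1)} {l : List (BraidMonoid n)}
    (hl : l ≠ []) {b : BraidMonoid n} :
    IsSplitting x (l ++ [b]) ↔
      IsSplitting (altProd l) l ∧ OnlyFirst (altProd l) ∧
        x = flip (n + 1) (altProd l) * incl n b := by
  have hpos := List.length_pos_iff.2 hl
  simp only [IsSplitting, altProd_append_singleton, List.length_append, List.length_singleton]
  constructor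
  · rintro ⟨-, rfl, h⟩
    refine ⟨⟨hl, trivial, fun k h₁ h₂ => ?_⟩, ?_, rfl⟩
    · simpa [List.take_append_of_le_length h₂.le] using h k h₁ (by omega)
    · simpa [OnlyFirst] using h l.length hpos (by omega)
  · rintro ⟨⟨-, -, h⟩, h', rfl⟩
    refine ⟨by simp, rfl, fun k h₁ h₂ => ?_⟩
    rcases (Nat.lt_succ_iff.1 h₂).lt_or_eq with h₃ | rfl
    · simpa [List.take_append_of_le_length h₃.le] using h k h₁ h₃
    · rw [List.take_left]
      exact h'

theorem OnlyFirst.tailFree_flip {x : BraidMonoid (n + 1)} (h : OnlyFirst x) :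
    TailFree (flip (n + 1) x) := by
  intro i hi
  have := i.2
  have := (h _).1 (isRightDivisor_σ_flip_iff.1 hi)
  simp only [flipIndex, castIndex] at this
  omega

theorem OnlyFirst.flip_ne_one (hn : 1 ≤ n) {x : BraidMonoid (n + 1)} (h : OnlyFirst x) :
    flip (n + 1) x ≠ 1 := by
  intro h₁
  have h₂ : x = 1 := by simpa using congrArg (flip (n + 1)) h₁
  exact not_isRightDivisor_σ_one _ (h₂ ▸ (h ⟨1, le_rfl, by omega⟩).2 rfl)

/-- With `OnlyFirst.tailFree_flip`, this translates the condition on splittings into tail-freeness: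
a nontrivial tail-free braid ends only in `σ_n`, which the flip turns into `σ_1`. -/
theorem TailFree.onlyFirst_flip {x : BraidMonoid (n + 1)} (hx : TailFree x) (hx₁ : x ≠ 1) :
    OnlyFirst (flip (n + 1) x) := by
  have key : ∀ i : BraidIndex (n + 1), IsRightDivisor (σ i) x → i.1 = n := fun i hi => by
    by_contra hne
    have := i.2
    exact hx ⟨i.1, i.2.1, by omega⟩ hi
  intro i
  have hi := i.2
  rw [isRightDivisor_σ_flip_iff]
  constructor
  · intro h
    have := key _ h
    simp only [flipIndex] at this
    omega
  · intro h
    obtain rfl | ⟨y, j, rfl⟩ := eq_one_or_eq_mul_σ x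
    · exact absurd rfl hx₁
    · have hj := key j ⟨y, rfl⟩
      have : flipIndex i = j := Subtype.ext (by simp only [flipIndex]; omega)
      exact ⟨y, by rw [this]⟩

theorem exists_isSplitting (hn : 2 ≤ n) (x : BraidMonoid (n + 1)) : ∃ l, IsSplitting x l := by
  classical
  -- Length alone does not drop when the split-off entry is `1`. In that case `x` is tail-free,
  -- hence not divisible by `σ_1`, while its flip is, so the second term drops.
  let μ : BraidMonoid (n + 1) → ℕ := fun x =>
    2 * length x + if IsRightDivisor (σFirst (n + 1) (Nat.le_succ_of_le hn)) x then 0 else 1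
  induction hN : μ x using Nat.strong_induction_on generalizing x with | _ N ih
  subst hN
  obtain ⟨y, b, hy, rfl⟩ := exists_tailFree_mul_incl x
  by_cases hy₁ : y = 1
  · exact ⟨[b], by simpa [hy₁] using isSplitting_singleton b⟩
  have ho := hy.onlyFirst_flip hy₁
  have hμ : μ (flip (n + 1) y) = 2 * length y := by
    simp [μ, σFirst, (ho _).2]
  obtain ⟨l, hl⟩ := ih (μ (flip (n + 1) y)) (by
    rw [hμ]
    obtain rfl | ⟨b, i, rfl⟩ := eq_one_or_eq_mul_σ b
    · have : ¬ IsRightDivisor (σFirst (n + 1) (Nat.le_succ_of_le hn)) y := hy ⟨1, le_rfl, hn⟩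
      simp [μ, this]
    · simp only [μ, map_mul, incl_σ, length_mul, length_σ]
      omega) _ rfl
  have hprod := hl.2.1
  refine ⟨l ++ [b], (isSplitting_append_singleton_iff hl.1).2 ⟨by rwa [hprod], by rwa [hprod], ?_⟩⟩
  rw [hprod, flip_flip]

theorem IsSplitting.unique (hn : 1 ≤ n) {x : BraidMonoid (n + 1)} {l m : List (BraidMonoid n)}
    (hl : IsSplitting x l) (hm : IsSplitting x m) : l = m := by
  induction l using List.reverseRecOn generalizing x m with
  | nil => exact absurd rfl hl.1
  | append_singleton l a ih =>
    obtain rfl | ⟨m, b, rfl⟩ := m.eq_nil_or_concat'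
    · exact absurd rfl hm.1
    by_cases hl₀ : l = [] <;> by_cases hm₀ : m = []
    · subst hl₀ hm₀
      have h := hl.2.1.trans hm.2.1.symm
      simp only [List.nil_append, altProd_singleton] at h
      rw [incl_injective n h]
    · subst hl₀
      obtain ⟨-, ho, h⟩ := (isSplitting_append_singleton_iff hm₀).1 hm
      rw [← hl.2.1, List.nil_append, altProd_singleton, ← one_mul (incl n a)] at h
      -- Splittings with one entry and with several cannot coexist: the tail-free factor would be
      -- both `1` and nontrivial.
      exact absurd (tailFree_one.mul_incl_inj ho.tailFree_flip h).1.symm (ho.flip_ne_one hn)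
    · subst hm₀
      obtain ⟨-, ho, h⟩ := (isSplitting_append_singleton_iff hl₀).1 hl
      rw [← hm.2.1, List.nil_append, altProd_singleton, ← one_mul (incl n b)] at h
      exact absurd (tailFree_one.mul_incl_inj ho.tailFree_flip h).1.symm (ho.flip_ne_one hn)
    · obtain ⟨hl', ho, h⟩ := (isSplitting_append_singleton_iff hl₀).1 hl
      obtain ⟨hm', ho', h'⟩ := (isSplitting_append_singleton_iff hm₀).1 hm
      obtain ⟨h₁, rfl⟩ := ho.tailFree_flip.mul_incl_inj ho'.tailFree_flip (h.symm.trans h')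
      have h₂ : altProd l = altProd m := by simpa using congrArg (flip (n + 1)) h₁
      rw [ih hl' (h₂ ▸ hm')]

/-- Right multiplication by an element of `B_n^+` changes the last entry of the splitting. -/
theorem IsSplitting.mul_incl {x : BraidMonoid (n + 1)} {l : List (BraidMonoid n)}
    {a : BraidMonoid n} (h : IsSplitting x (l ++ [a])) (b : BraidMonoid n) :
    IsSplitting (x * incl n b) (l ++ [a * b]) := by
  by_cases hl : l = []
  · subst hl
    rw [← h.2.1, List.nil_append, altProd_singleton, ← map_mul]
    exact isSplitting_singleton _
  · rw [isSplitting_append_singleton_iff hl] at h ⊢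
    exact ⟨h.1, h.2.1, by rw [h.2.2, map_mul, mul_assoc]⟩

theorem isSplitting_σLast (hn : 2 ≤ n) :
    IsSplitting (σLast (n + 1) (Nat.le_succ_of_le hn)) [σFirst n hn, 1] := by
  have h : [σFirst n hn, 1] = [σFirst n hn] ++ [1] := rfl
  rw [h, isSplitting_append_singleton_iff (by simp), altProd_singleton]
  refine ⟨isSplitting_singleton _, fun i => ?_, ?_⟩
  · rw [σFirst, incl_σ, isRightDivisor_σ_σ_iff, Subtype.ext_iff, castIndex]
  · rw [map_one, mul_one]
    rfl

end BraidMonoid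

/-! ### Shortlex orders -/

/-- A list caught between two lists with common prefix `l` must itself begin with `l`, by asymmetry,
so only the last entries are compared. -/
theorem List.Lex.not_between_append_singleton {α : Type*} {r : α → α → Prop} [Std.Asymm r]
    {a a' : α} (h : ∀ b, r a b → ¬ r b a') {l m : List α} (hm : m.length = l.length + 1)
    (h₁ : List.Lex r (l ++ [a]) m) : ¬ List.Lex r m (l ++ [a']) := by
  intro h₂
  induction l generalizing m with
  | nil =>
    obtain ⟨b, rfl⟩ := List.length_eq_one_iff.1 hm
    simp only [List.nil_append, List.lex_singleton_iff] at h₁ h₂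
    exact h b h₁ h₂
  | cons c l ih =>
    rw [List.cons_append] at h₁ h₂
    cases h₁ with
    | cons h₁ =>
      cases h₂ with
      | cons h₂ => exact ih (by simpa using hm) h₁ h₂
      | rel h₂ => exact Std.Asymm.asymm _ _ h₂ h₂
    | rel h₁ =>
      cases h₂ with
      | cons h₂ => exact Std.Asymm.asymm _ _ h₁ h₁
      | rel h₂ => exact Std.Asymm.asymm _ _ h₁ h₂

theorem List.Shortlex.not_between_append_singleton {α : Type*} {r : α → α → Prop} [Std.Asymm r]
    {a a' : α} (h : ∀ b, r a b → ¬ r b a') {l m : List α} (h₁ : List.Shortlex r (l ++ [a]) m) :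
    ¬ List.Shortlex r m (l ++ [a']) := by
  intro h₂
  rw [List.shortlex_def, List.length_append, List.length_singleton] at h₁ h₂
  have hm : m.length = l.length + 1 := by omega
  exact List.Lex.not_between_append_singleton h hm (h₁.resolve_left (by omega)).2
    (h₂.resolve_left (by omega)).2

namespace BraidMonoid

/-! ### The order -/

theorem eq_σFirst_pow_length (x : BraidMonoid 2) : x = σFirst 2 le_rfl ^ length x := by
  induction x using induction_right with
  | one => simp
  | mul x i ih =>
    have hi := i.2
    have : i = ⟨1, le_rfl, one_lt_two⟩ := Subtype.ext (show i.1 = 1 by omega)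
    rw [length_mul, length_σ, pow_succ, ← ih, this]
    rfl

theorem length_σFirst_pow (p : ℕ) : length (σFirst 2 le_rfl ^ p) = p := by
  induction p with
  | zero => simp
  | succ p ih => rw [pow_succ, length_mul, ih]; rfl

theorem lt_two_iff {x y : BraidMonoid 2} : lt 2 x y ↔ length x < length y := by
  constructor
  · rintro ⟨p, q, h, rfl, rfl⟩
    rwa [length_σFirst_pow, length_σFirst_pow]
  · intro h
    exact ⟨_, _, h, eq_σFirst_pow_length x, eq_σFirst_pow_length y⟩

theorem length_injective_two : Function.Injective (length : BraidMonoid 2 → ℕ) := fun x y h => by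
  rw [eq_σFirst_pow_length x, h, ← eq_σFirst_pow_length]

theorem lt_iff_of_isSplitting {n : ℕ} {x y : BraidMonoid (n + 3)}
    {l m : List (BraidMonoid (n + 2))} (hl : IsSplitting x l) (hm : IsSplitting y m) :
    lt (n + 3) x y ↔ List.Shortlex (lt (n + 2)) l m := by
  constructor
  · rintro ⟨l', m', hl', hm', h⟩
    rwa [hl.unique (by omega) hl', hm.unique (by omega) hm']
  · intro h
    exact ⟨l, m, hl, hm, h⟩

/-- A braid is recovered from its splitting by `altProd`, so the pull-back is along an injection and
inherits trichotomy as well as well-foundedness. -/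
theorem isWellOrder_lt (n : ℕ) : IsWellOrder (BraidMonoid (n + 2)) (lt (n + 2)) := by
  induction n with
  | zero =>
    have h : lt 2 = InvImage (· < ·) length := by
      ext x y
      exact lt_two_iff
    rw [Nat.zero_add, h]
    exact { wf := InvImage.wf _ Nat.lt_wfRel.wf
            toTrichotomous := InvImage.trichotomous length_injective_two }
  | succ n ih =>
    choose S hS using exists_isSplitting (n := n + 2) (by omega)
    have h : lt (n + 3) = InvImage (List.Shortlex (lt (n + 2))) S := by
      ext x y
      exact lt_iff_of_isSplitting (hS x) (hS y)
    have hinj : Function.Injective S := fun x y hxy => by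
      rw [← (hS x).2.1, hxy, (hS y).2.1]
    change IsWellOrder (BraidMonoid (n + 3)) (lt (n + 3))
    rw [h]
    exact { wf := InvImage.wf _ (List.Shortlex.wf ih.wf)
            toTrichotomous := InvImage.trichotomous hinj }

theorem not_lt_one (n : ℕ) (x : BraidMonoid (n + 2)) : ¬ lt (n + 2) x 1 := by
  induction n with
  | zero => simp [lt_two_iff]
  | succ n ih =>
    obtain ⟨l, hl⟩ := exists_isSplitting (by omega) x
    have h₁ : IsSplitting (1 : BraidMonoid (n + 3)) [1] := by
      simpa using isSplitting_singleton (1 : BraidMonoid (n + 2))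
    rw [lt_iff_of_isSplitting hl h₁]
    intro h
    have hpos := List.length_pos_iff.2 hl.1
    obtain ⟨a, rfl⟩ : ∃ a, l = [a] := by
      rw [List.shortlex_def, List.length_singleton] at h
      exact List.length_eq_one_iff.1 (by omega)
    exact ih a ((List.shortlex_singleton_iff _ _).1 h)

theorem exists_isSplitting_append (n : ℕ) (x : BraidMonoid (n + 3)) :
    ∃ l a, IsSplitting x (l ++ [a]) := by
  obtain ⟨l, hl⟩ := exists_isSplitting (n := n + 2) (by omega) x
  obtain rfl | ⟨l, a, rfl⟩ := l.eq_nil_or_concat'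
  · exact absurd rfl hl.1
  · exact ⟨l, a, hl⟩

/-- `x σ_1` is the immediate successor of `x`. -/
theorem lt_mul_σFirst_and_not_between (n : ℕ) (x : BraidMonoid (n + 2)) :
    lt (n + 2) x (x * σFirst (n + 2) (by omega)) ∧
      ∀ y, lt (n + 2) x y → ¬ lt (n + 2) y (x * σFirst (n + 2) (by omega)) := by
  induction n with
  | zero =>
    have h : length (x * σFirst (0 + 2) le_rfl) = length x + 1 := length_mul _ _
    refine ⟨lt_two_iff.2 (by omega), fun y hxy hyx => ?_⟩
    have h₁ := lt_two_iff.1 hxy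
    have h₂ := lt_two_iff.1 hyx
    omega
  | succ n ih =>
    have := isWellOrder_lt n
    obtain ⟨l, a, hx⟩ := exists_isSplitting_append n x
    have hx' := hx.mul_incl (σFirst (n + 2) (by omega))
    change IsSplitting (x * σFirst (n + 3) (by omega)) _ at hx'
    refine ⟨(lt_iff_of_isSplitting hx hx').2 (List.Shortlex.append_left
      ((List.shortlex_singleton_iff _ _).2 (ih a).1) l), fun y => ?_⟩
    obtain ⟨m, hm⟩ := exists_isSplitting (n := n + 2) (by omega) y
    change lt (n + 3) x y → ¬ lt (n + 3) y _
    rw [lt_iff_of_isSplitting hx hm, lt_iff_of_isSplitting hm hx']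
    exact List.Shortlex.not_between_append_singleton (ih a).2

theorem lt_incl_incl_iff {n : ℕ} {x y : BraidMonoid (n + 2)} :
    lt (n + 3) (incl (n + 2) x) (incl (n + 2) y) ↔ lt (n + 2) x y := by
  rw [lt_iff_of_isSplitting (isSplitting_singleton x) (isSplitting_singleton y),
    List.shortlex_singleton_iff]

theorem range_incl_eq (n : ℕ) : Set.range (incl (n + 2)) =
    {x : BraidMonoid (n + 3) | lt (n + 3) x (σLast (n + 3) (by omega))} := by
  have hlast := isSplitting_σLast (n := n + 2) (by omega)
  ext x
  constructor
  · rintro ⟨x, rfl⟩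
    exact (lt_iff_of_isSplitting (isSplitting_singleton x) hlast).2
      (List.Shortlex.of_length_lt (by simp))
  · intro hx
    obtain ⟨l, a, hl⟩ := exists_isSplitting_append n x
    by_cases hl₀ : l = []
    · subst hl₀
      exact ⟨a, by simpa using hl.2.1⟩
    exfalso
    have hlen := List.length_pos_iff.2 hl₀
    have h := (lt_iff_of_isSplitting hl hlast).1 hx
    rw [List.shortlex_def] at h
    simp only [List.length_append, List.length_cons, List.length_nil] at h
    replace h := h.resolve_left (by omega)
    obtain ⟨b, rfl⟩ := List.length_eq_one_iff.1 (show l.length = 1 by omega)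
    have ho := ((isSplitting_append_singleton_iff hl₀).1 hl).2.1
    cases h.2 with
    | cons h => exact not_lt_one n a ((List.lex_singleton_iff _ _).1 h)
    -- Here `b < σ_1`, and `σ_1` is the successor of the least element `1`, so `b = 1`; but a first
    -- entry followed by another must be right divisible by `σ_1`.
    | rel h =>
      have := isWellOrder_lt n
      have hb : b ≠ 1 := by
        rintro rfl
        exact not_isRightDivisor_σ_one (n := n + 3) ⟨1, le_rfl, by omega⟩
          (by simpa using (ho ⟨1, le_rfl, by omega⟩).2 rfl)
      rcases trichotomous_of (lt (n + 2)) 1 b with h₁ | h₁ | h₁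
      · exact (lt_mul_σFirst_and_not_between n 1).2 b h₁ (by simpa using h)
      · exact hb h₁.symm
      · exact not_lt_one n b h₁

end BraidMonoid

theorem proposition4p14 :
    (∀ (n : ℕ) (hn : 2 ≤ n),
      IsStrictTotalOrder (BraidMonoid n) (BraidMonoid.lt n) ∧
      WellFounded (BraidMonoid.lt n) ∧
      ∀ x : BraidMonoid n,
        BraidMonoid.lt n x (x * BraidMonoid.σFirst n hn) ∧
        ¬ ∃ y : BraidMonoid n,
          BraidMonoid.lt n x y ∧ BraidMonoid.lt n y (x * BraidMonoid.σFirst n hn)) ∧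
    (∀ (n : ℕ) (_ : 2 ≤ n),
      Function.Injective (BraidMonoid.incl n) ∧
      (∀ x y : BraidMonoid n,
        BraidMonoid.lt (n + 1) (BraidMonoid.incl n x) (BraidMonoid.incl n y) ↔
          BraidMonoid.lt n x y) ∧
      Set.range (BraidMonoid.incl n) =
        {x : BraidMonoid (n + 1) |
          BraidMonoid.lt (n + 1) x (BraidMonoid.σLast (n + 1) (by omega))}) := by
  refine ⟨fun n hn => ?_, fun n hn => ?_⟩
  · obtain ⟨n, rfl⟩ := Nat.exists_eq_add_of_le' hn
    have := BraidMonoid.isWellOrder_lt n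
    refine ⟨inferInstance, IsWellFounded.wf, fun x => ?_⟩
    obtain ⟨h₁, h₂⟩ := BraidMonoid.lt_mul_σFirst_and_not_between n x
    exact ⟨h₁, fun ⟨y, hxy, hyx⟩ => h₂ y hxy hyx⟩
  · obtain ⟨n, rfl⟩ := Nat.exists_eq_add_of_le' hn
    exact ⟨BraidMonoid.incl_injective _, fun _ _ => BraidMonoid.lt_incl_incl_iff,
      BraidMonoid.range_incl_eq n⟩
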